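/- For every integer $h \ge 0$ there are constants $c > 0$ and $C$, depending only on $h$, and a family of finite simple graphs containing graphs with arbitrarily many vertices, such that every graph $G$ in the family, with $n$ vertices and $m$ edges, is $3$-regular, has girth at least $c\log n$, and satisfies the following: every $K_h$-minor-free induced subgraph of $G$ has at most $$n-\frac{m}{6}+C\,\frac{m}{\log m}$$ vertices. (A graph is $K_h$-minor-free if the complete graph on $h$ vertices is not a minor of it. The girth is the length of a shortest cycle.) -/

import Mathlib

namespace SimpleGraph

/-- `H` is a minor of `G`: there are pairwise disjoint vertex sets of `G` (branch sets), one for each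
vertex of `H`, each inducing a connected (in particular nonempty) subgraph of `G`, such that any two
branch sets belonging to adjacent vertices of `H` are joined by an edge of `G`. -/
def IsMinor {W V : Type*} (H : SimpleGraph W) (G : SimpleGraph V) : Prop :=
  ∃ B : W → Set V,
    (∀ w, (G.induce (B w)).Connected) ∧
    (∀ u w, u ≠ w → Disjoint (B u) (B w)) ∧
    (∀ u w, H.Adj u w → ∃ x ∈ B u, ∃ y ∈ B w, G.Adj x y)

/-- `G` is `K_h`-minor-free: the complete graph on `h` vertices is not a minor of `G`. -/
def CompleteMinorFree {V : Type*} (G : SimpleGraph V) (h : ℕ) : Prop :=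
  ¬ (completeGraph (Fin h)).IsMinor G

end SimpleGraph

/-! A cubic graph has m = 3n/2, and deleting the vertices outside S destroys at most 3(n - |S|)
edges, so the subgraph H induced on S keeps at least 3|S| - 3n/2 edges. If H is also shown to have
at most (1 + O(1/g))|S| edges, where g is the girth, then |S| ≤ 3n/4 + O(n/g). Here 3n/4 = n - m/6,
and logarithmic girth turns the error into O(m / log m).

The upper bound is `card_edgeFinset_le_of_completeMinorFree`. Split H into breadth-first trees
around a maximal set of roots at pairwise distance more than 2r, with r about g/8. The girth
excludes non-tree edges inside a tree and double edges between two trees, so contracting the trees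
loses at most |S| edges. The quotient has no K_h minor, so its edges are linear in its non-isolated
vertices (`hasModelIn_of_le_degreeSum`), and each of these stands for more than r vertices of H.

The graphs (`exists_cubic_graph_girth`) are Cayley graphs of GL_3(Z/4^L) on three reflections. Over
Z these satisfy no relations except being involutions, and short reduced words stay nontrivial
modulo 4^L. -/

namespace SimpleGraph

/-! ### Complete minors from large average degree -/

/-- An average degree that forces a complete minor on `h` vertices. -/
def minorDegree : ℕ → ℕ
  | 0 => 0
  | h + 1 => 2 * minorDegree h + 2

/-- A model of the complete graph on `h` vertices with all branch sets inside `W`. -/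
def HasModelIn {V : Type*} (G : SimpleGraph V) (h : ℕ) (W : Set V) : Prop :=
  ∃ B : Fin h → Set V,
    (∀ i, B i ⊆ W) ∧
    (∀ i, (G.induce (B i)).Connected) ∧
    (∀ i j, i ≠ j → Disjoint (B i) (B j)) ∧
    (∀ i j, i ≠ j → ∃ x ∈ B i, ∃ y ∈ B j, G.Adj x y)

lemma HasModelIn.mono {V : Type*} {G : SimpleGraph V} {h : ℕ} {W W' : Set V} (hW : W ⊆ W')
    (H : G.HasModelIn h W) : G.HasModelIn h W' := by
  obtain ⟨B, h1, h2⟩ := H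
  exact ⟨B, fun i => (h1 i).trans hW, h2⟩

/-- A connected set `U` dominating `W` from outside adds a branch set to every model in `W`. -/
lemma HasModelIn.succ {V : Type*} {G : SimpleGraph V} {h : ℕ} {U W W' : Set V}
    (H : G.HasModelIn h W) (hU : (G.induce U).Connected) (hUW : Disjoint U W)
    (hdom : ∀ x ∈ W, ∃ u ∈ U, G.Adj u x) (hUW' : U ⊆ W') (hWW' : W ⊆ W') :
    G.HasModelIn (h + 1) W' := by
  obtain ⟨B, hB, hc, hd, ha⟩ := H
  have key : ∀ i, ∃ x ∈ U, ∃ y ∈ B i, G.Adj x y := by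
    intro i
    obtain ⟨⟨y, hy⟩⟩ := (hc i).nonempty
    obtain ⟨u, hu, huy⟩ := hdom y (hB i hy)
    exact ⟨u, hu, y, hy, huy⟩
  refine ⟨Fin.cons U B, ?_, ?_, ?_, ?_⟩
  · intro i
    refine Fin.cases ?_ (fun i => ?_) i
    · exact hUW'
    · exact (hB i).trans hWW'
  · intro i
    refine Fin.cases ?_ (fun i => ?_) i
    · exact hU
    · exact hc i
  · intro i j
    refine Fin.cases ?_ (fun i => ?_) i <;> refine Fin.cases ?_ (fun j => ?_) j <;> intro hij
    · exact absurd rfl hij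
    · exact hUW.mono_right (hB j)
    · exact (hUW.mono_right (hB i)).symm
    · exact hd i j (fun h => hij (by rw [h]))
  · intro i j
    refine Fin.cases ?_ (fun i => ?_) i <;> refine Fin.cases ?_ (fun j => ?_) j <;> intro hij
    · exact absurd rfl hij
    · exact key j
    · obtain ⟨x, hx, y, hy, hxy⟩ := key i
      exact ⟨y, hy, x, hx, hxy.symm⟩
    · exact ha i j (fun h => hij (by rw [h]))

section DegreeSum

variable {V : Type*} [DecidableEq V] (G : SimpleGraph V) [DecidableRel G.Adj]

/-- The neighbours of `x` lying in `W`. -/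
def nbrsIn (W : Finset V) (x : V) : Finset V := W.filter (G.Adj x)

/-- The sum of the degrees of the subgraph induced on `W`. -/
def degreeSum (W : Finset V) : ℕ := ∑ x ∈ W, (G.nbrsIn W x).card

/-- The factor 2: the summand of `x` disappears, and each neighbour of `x` loses one. -/
lemma degreeSum_erase {W : Finset V} {x : V} (hx : x ∈ W) :
    G.degreeSum (W.erase x) + 2 * (G.nbrsIn W x).card = G.degreeSum W := by
  have h1 : ∀ y ∈ W.erase x, (G.nbrsIn W y).card
      = (G.nbrsIn (W.erase x) y).card + if G.Adj x y then 1 else 0 := by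
    intro y hy
    have : G.nbrsIn (W.erase x) y = (G.nbrsIn W y).erase x := by
      ext z; simp [nbrsIn]; tauto
    rw [this]
    split_ifs with h
    · rw [Finset.card_erase_add_one]
      simp [nbrsIn, hx, h.symm]
    · rw [Finset.erase_eq_of_notMem, add_zero]
      simp [nbrsIn, G.adj_comm y x, h]
  have h2 : ∑ y ∈ W.erase x, (if G.Adj x y then 1 else 0) = (G.nbrsIn W x).card := by
    rw [← Finset.card_filter]
    congr 1
    ext z
    simp only [nbrsIn, Finset.mem_filter, Finset.mem_erase]
    constructor
    · rintro ⟨⟨_, h⟩, h'⟩; exact ⟨h, h'⟩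
    · rintro ⟨h, h'⟩; exact ⟨⟨h'.ne', h⟩, h'⟩
  rw [degreeSum, degreeSum, ← Finset.add_sum_erase _ _ hx, Finset.sum_congr rfl h1,
    Finset.sum_add_distrib, h2]
  ring

/-- The vertices of `W` outside `U` with a neighbour in `U`. -/
def boundaryIn (W U : Finset V) : Finset V := (W \ U).filter fun x => ∃ u ∈ U, G.Adj u x

/-- Absorbing a boundary vertex `x` into `U` trades `x` for its new outside neighbours. -/
lemma card_boundaryIn_insert {W U : Finset V} {x : V} (hx : x ∈ G.boundaryIn W U) :
    (G.boundaryIn W (insert x U)).card + 1 + (G.nbrsIn (G.boundaryIn W U) x).card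
      = (G.boundaryIn W U).card + (G.nbrsIn (W \ U) x).card := by
  have h1 : G.boundaryIn W (insert x U) = (G.boundaryIn W U).erase x ∪ G.nbrsIn (W \ U) x := by
    ext y
    have hne : G.Adj x y → y ≠ x := fun h => h.ne'
    simp only [boundaryIn, nbrsIn, Finset.mem_filter, Finset.mem_sdiff, Finset.mem_insert,
      Finset.mem_union, Finset.mem_erase, exists_eq_or_imp]
    generalize (∃ a ∈ U, G.Adj a y) = P
    by_cases hyx : y = x
    · have : ¬ G.Adj x y := fun h => hne h hyx
      tauto
    · tauto
  have h2 : (G.boundaryIn W U).erase x ∩ G.nbrsIn (W \ U) x = G.nbrsIn (G.boundaryIn W U) x := by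
    ext y
    have hne : G.Adj x y → y ≠ x := fun h => h.ne'
    simp only [boundaryIn, nbrsIn, Finset.mem_filter, Finset.mem_sdiff,
      Finset.mem_inter, Finset.mem_erase]
    tauto
  have h3 := Finset.card_union_add_card_inter ((G.boundaryIn W U).erase x) (G.nbrsIn (W \ U) x)
  have h4 := Finset.card_erase_add_one hx
  rw [h1, ← h2]
  omega

end DegreeSum

/-- A graph of large average degree contains a large complete minor. -/
theorem hasModelIn_of_le_degreeSum {V : Type*} [DecidableEq V] (G : SimpleGraph V)
    [DecidableRel G.Adj] (h : ℕ) (W : Finset V) (hW : W.Nonempty)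
    (hdeg : minorDegree h * W.card ≤ G.degreeSum W) : G.HasModelIn h (W : Set V) := by
  classical
  induction h generalizing W with
  | zero => exact ⟨Fin.elim0, fun i => i.elim0, fun i => i.elim0, fun i => i.elim0, fun i => i.elim0⟩
  | succ h ih =>
  induction W using Finset.strongInduction with
  | H W ihW =>
  set D := minorDegree (h + 1) with hD
  have hD' : D = 2 * minorDegree h + 2 := rfl
  -- The inequality says that contracting `U` to a point leaves average degree at least `D`: there
  -- remain `(W \ U).card + 1` vertices, and every boundary vertex sends one edge to the new point.
  let good : Finset (Finset V) := W.powerset.filter fun U =>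
    (G.induce (U : Set V)).Connected ∧
      D * ((W \ U).card + 1) ≤ G.degreeSum (W \ U) + 2 * (G.boundaryIn W U).card
  have hgood : good.Nonempty := by
    obtain ⟨v, hv⟩ := hW
    refine ⟨{v}, ?_⟩
    have hb : G.boundaryIn W {v} = G.nbrsIn W v := by
      ext y
      have hne : G.Adj v y → y ≠ v := fun h => h.ne'
      simp only [boundaryIn, nbrsIn, Finset.mem_filter, Finset.mem_sdiff, Finset.mem_singleton,
        exists_eq_left]
      tauto
    simp only [good, Finset.mem_filter, Finset.mem_powerset, Finset.singleton_subset_iff]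
    refine ⟨hv, ?_, ?_⟩
    · rw [Finset.coe_singleton]
      have : Nonempty ({v} : Set V) := ⟨⟨v, rfl⟩⟩
      have : Subsingleton ({v} : Set V) := inferInstance
      exact ⟨fun a b => by rw [Subsingleton.elim a b]⟩
    · rw [hb, Finset.sdiff_singleton_eq_erase, G.degreeSum_erase hv, Finset.card_erase_add_one hv]
      exact hdeg
  obtain ⟨U, hU, hmax⟩ := Finset.exists_max_image good Finset.card hgood
  simp only [good, Finset.mem_filter, Finset.mem_powerset] at hU
  obtain ⟨hUW, hUc, hUD⟩ := hU
  obtain ⟨⟨u₀, hu₀⟩⟩ := hUc.nonempty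
  by_cases hN : (G.boundaryIn W U).Nonempty
  -- Absorbing `x` costs one vertex and `1 + t` edges, `t` being the number of its neighbours in the
  -- boundary. Maximality of `U` forces `2 * (1 + t) > D`; this is the source of the recursion for
  -- `minorDegree`.
  · have hmin : ∀ x ∈ G.boundaryIn W U,
        minorDegree h ≤ (G.nbrsIn (G.boundaryIn W U) x).card := by
      intro x hx
      have hx' := hx
      simp only [boundaryIn, Finset.mem_filter, Finset.mem_sdiff] at hx'
      obtain ⟨⟨hxW, hxU⟩, u, huU, hux⟩ := hx'
      have hconn : (G.induce ((insert x U : Finset V) : Set V)).Connected := by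
        have h1 : (G.induce ({x} : Set V)).Preconnected := fun a b => by
          rw [Subsingleton.elim a b]
        have := connected_induce_union hUc.preconnected h1 (v := u) (w := x) huU rfl hux
        rw [Finset.coe_insert, Set.insert_eq, Set.union_comm]
        exact this
      have hnot : insert x U ∉ good := fun hmem => by
        have := hmax _ hmem
        rw [Finset.card_insert_of_notMem hxU] at this
        omega
      simp only [good, Finset.mem_filter, Finset.mem_powerset, not_and, not_le] at hnot
      have hlt := hnot (Finset.insert_subset hxW hUW) hconn
      have hxR : x ∈ W \ U := Finset.mem_sdiff.2 ⟨hxW, hxU⟩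
      have he : W \ insert x U = (W \ U).erase x := by
        ext y; simp only [Finset.mem_sdiff, Finset.mem_insert, Finset.mem_erase]; tauto
      rw [he, Finset.card_erase_add_one hxR] at hlt
      have e1 := G.degreeSum_erase hxR
      have e2 := G.card_boundaryIn_insert hx
      rw [mul_add] at hUD
      omega
    have hmod : G.HasModelIn h (G.boundaryIn W U : Set V) := by
      apply ih _ hN
      rw [degreeSum, mul_comm, ← smul_eq_mul]
      exact Finset.card_nsmul_le_sum _ _ _ hmin
    refine hmod.succ hUc ?_ ?_ (by exact_mod_cast hUW) ?_
    · rw [Finset.disjoint_coe, Finset.disjoint_left]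
      intro y hy hy'
      simp only [boundaryIn, Finset.mem_filter, Finset.mem_sdiff] at hy'
      exact hy'.1.2 hy
    · intro x hx
      exact (Finset.mem_filter.1 (Finset.mem_coe.1 hx)).2
    · intro x hx
      exact (Finset.mem_sdiff.1 (Finset.mem_filter.1 (Finset.mem_coe.1 hx)).1).1
  · rw [Finset.not_nonempty_iff_eq_empty] at hN
    -- Without a boundary `U` carries none of the counted edges, so the smaller set `W \ U` is
    -- already dense enough.
    rw [hN, Finset.card_empty, mul_zero, add_zero] at hUD
    have hne : (W \ U).Nonempty := by
      by_contra h0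
      rw [Finset.not_nonempty_iff_eq_empty] at h0
      rw [h0] at hUD
      simp [degreeSum] at hUD
      omega
    have hss : W \ U ⊂ W := by
      refine Finset.ssubset_iff_subset_ne.2 ⟨Finset.sdiff_subset, fun h0 => ?_⟩
      have : u₀ ∈ W \ U := by rw [h0]; exact hUW hu₀
      exact (Finset.mem_sdiff.1 this).2 hu₀
    refine (ihW _ hss hne (le_trans (Nat.mul_le_mul_left _ (Nat.le_succ _)) hUD)).mono ?_
    exact_mod_cast Finset.sdiff_subset

/-- The number of edges of a graph without a complete minor on `h` vertices is linear in the number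
of non-isolated vertices. -/
theorem two_mul_card_edgeFinset_le {V : Type*} [Fintype V] [DecidableEq V] (G : SimpleGraph V)
    [DecidableRel G.Adj] (h : ℕ) (W : Finset V) (hsupp : ∀ x y, G.Adj x y → x ∈ W)
    (hG : ¬ G.HasModelIn h (W : Set V)) :
    2 * G.edgeFinset.card ≤ minorDegree h * W.card := by
  have h1 : G.degreeSum W = 2 * G.edgeFinset.card := by
    rw [← G.sum_degrees_eq_twice_card_edges, degreeSum]
    have h2 : ∀ x, (G.nbrsIn W x) = G.neighborFinset x := by
      intro x; ext y
      simp only [nbrsIn, Finset.mem_filter, mem_neighborFinset, and_iff_right_iff_imp]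
      exact fun hxy => hsupp y x hxy.symm
    simp only [h2, card_neighborFinset_eq_degree]
    apply Finset.sum_subset (Finset.subset_univ _)
    intro x _ hx
    rw [← card_neighborFinset_eq_degree, Finset.card_eq_zero, Finset.eq_empty_iff_forall_notMem]
    intro y hy
    exact hx (hsupp x y ((mem_neighborFinset _ _ _).1 hy))
  rw [← h1]
  rcases W.eq_empty_or_nonempty with rfl | hW
  · simp [degreeSum]
  · by_contra hlt
    exact hG (hasModelIn_of_le_degreeSum G h W hW (by omega))

end SimpleGraph

/-! ### Contracting breadth-first trees in graphs of large girth -/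

namespace SimpleGraph

/-- A spanning forest of trees of depth at most `2 * r`, each grown breadth-first from its root,
with roots at pairwise distance more than `2 * r`. -/
structure BFSForest {V : Type*} (H : SimpleGraph V) (r : ℕ) where
  depth : V → ℕ
  parent : V → V
  root : V → V
  depth_le : ∀ v, depth v ≤ 2 * r
  adj_parent : ∀ v, depth v ≠ 0 → H.Adj v (parent v)
  depth_parent : ∀ v, depth v ≠ 0 → depth (parent v) + 1 = depth v
  root_parent : ∀ v, depth v ≠ 0 → root (parent v) = root v
  root_eq_self : ∀ v, depth v = 0 → root v = v
  depth_le_length : ∀ v a, depth a = 0 → ∀ w : H.Walk v a, depth v ≤ w.length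
  separated : ∀ a b, depth a = 0 → depth b = 0 → ∀ w : H.Walk a b, w.length ≤ 2 * r → a = b

/-- The roots form a maximal set at pairwise distance more than `2 * r`; maximality bounds every
depth by `2 * r`. The parent is the next vertex on a shortest walk to the roots. -/
theorem exists_bfsForest {V : Type*} [Fintype V] (H : SimpleGraph V) (r : ℕ) :
    Nonempty (BFSForest H r) := by
  classical
  let good : Finset (Finset V) := Finset.univ.filter fun Z =>
    ∀ a ∈ Z, ∀ b ∈ Z, ∀ w : H.Walk a b, w.length ≤ 2 * r → a = b
  obtain ⟨Z, hZ, hmax⟩ := Finset.exists_max_image good Finset.card ⟨∅, by simp [good]⟩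
  simp only [good, Finset.mem_filter, Finset.mem_univ, true_and] at hZ
  have hcov : ∀ v, ∃ z ∈ Z, ∃ w : H.Walk v z, w.length ≤ 2 * r := by
    intro v
    by_contra hv
    push Not at hv
    have hvZ : v ∉ Z := fun h => absurd (hv v h .nil) (by simp)
    have : insert v Z ∈ good := by
      simp only [good, Finset.mem_filter, Finset.mem_univ, true_and, Finset.mem_insert]
      rintro a (rfl | ha) b (rfl | hb) w hw
      · rfl
      · exact absurd (hv b hb w) (by omega)
      · exact absurd (hv a ha w.reverse) (by rw [Walk.length_reverse]; omega)
      · exact hZ a ha b hb w hw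
    have := hmax _ this
    rw [Finset.card_insert_of_notMem hvZ] at this
    omega
  have hex : ∀ v, ∃ k, ∃ z ∈ Z, ∃ w : H.Walk v z, w.length = k := fun v => by
    obtain ⟨z, hz, w, -⟩ := hcov v
    exact ⟨_, z, hz, w, rfl⟩
  let t : V → ℕ := fun v => Nat.find (hex v)
  have ht : ∀ v, ∃ z ∈ Z, ∃ w : H.Walk v z, w.length = t v := fun v => Nat.find_spec (hex v)
  have htle : ∀ v, ∀ z ∈ Z, ∀ w : H.Walk v z, t v ≤ w.length := fun v z hz w =>
    Nat.find_min' (hex v) ⟨z, hz, w, rfl⟩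
  have hpar : ∀ v, ∃ u, t v ≠ 0 → H.Adj v u ∧ t u + 1 = t v := by
    intro v
    obtain ⟨z, hz, w, hw⟩ := ht v
    cases w with
    | nil => exact ⟨v, fun h => absurd hw.symm h⟩
    | @cons _ u _ hvu w' =>
      refine ⟨u, fun _ => ⟨hvu, ?_⟩⟩
      have h1 := htle u z hz w'
      obtain ⟨z', hz', w'', hw''⟩ := ht u
      have h2 := htle v z' hz' (.cons hvu w'')
      rw [Walk.length_cons] at hw h2
      omega
  choose p hp using hpar
  have hmem : ∀ v, t v = 0 → v ∈ Z := by
    intro v hv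
    obtain ⟨z, hz, w, hw⟩ := ht v
    rw [hv] at hw
    rwa [Walk.eq_of_length_eq_zero hw]
  exact ⟨{
    depth := t
    parent := p
    root := fun v => p^[t v] v
    depth_le := fun v => by
      obtain ⟨z, hz, w, hw⟩ := hcov v
      exact (htle v z hz w).trans hw
    adj_parent := fun v hv => (hp v hv).1
    depth_parent := fun v hv => (hp v hv).2
    root_parent := fun v hv => by
      rw [← (hp v hv).2, Function.iterate_succ_apply]
    root_eq_self := fun v hv => by rw [hv]; rfl
    depth_le_length := fun v a ha => htle v a (hmem a ha)
    separated := fun a b ha hb => hZ a (hmem a ha) b (hmem b hb) }⟩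

/-- An edge closing a walk that avoids it lies on a cycle at most one longer than the walk. -/
lemma exists_isCycle_of_walk {V : Type*} {H : SimpleGraph V} {u v : V} (huv : H.Adj u v)
    (w : H.Walk v u) (hw : s(u, v) ∉ w.edges) :
    ∃ c : H.Walk u u, c.IsCycle ∧ c.length ≤ w.length + 1 := by
  classical
  refine ⟨.cons huv w.bypass, ?_, ?_⟩
  · exact (Walk.cons_isCycle_iff _ _).2
      ⟨w.bypass_isPath, fun h => hw (w.edges_bypass_subset_edges h)⟩
  · rw [Walk.length_cons]
    exact Nat.succ_le_succ w.length_bypass_le_length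

namespace BFSForest

variable {V : Type*} {H : SimpleGraph V} {r : ℕ} (F : BFSForest H r)

/-- The edges of the forest. -/
def edges : Set (Sym2 V) := {e | ∃ x, F.depth x ≠ 0 ∧ e = s(x, F.parent x)}

lemma exists_walk_root (v : V) : ∃ w : H.Walk v (F.root v), w.length ≤ F.depth v ∧
    (∀ e ∈ w.edges, e ∈ F.edges) ∧ (∀ x ∈ w.support, F.root x = F.root v) := by
  induction hk : F.depth v generalizing v with
  | zero =>
    rw [F.root_eq_self v hk]
    exact ⟨.nil, by simp, by simp, by simp [F.root_eq_self v hk]⟩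
  | succ k ih =>
    have h0 : F.depth v ≠ 0 := by omega
    obtain ⟨w, hw, he, hs⟩ := ih (F.parent v) (by have := F.depth_parent v h0; omega)
    refine ⟨(Walk.cons (F.adj_parent v h0) w).copy rfl (F.root_parent v h0), ?_, ?_, ?_⟩
    · simp [hw]
    · simp only [Walk.edges_copy, Walk.edges_cons, List.mem_cons, forall_eq_or_imp]
      exact ⟨⟨v, h0, rfl⟩, he⟩
    · simp only [Walk.support_copy, Walk.support_cons, List.mem_cons, forall_eq_or_imp]
      exact ⟨trivial, fun x hx => (hs x hx).trans (F.root_parent v h0)⟩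

lemma depth_root (v : V) : F.depth (F.root v) = 0 := by
  induction hk : F.depth v generalizing v with
  | zero => rwa [F.root_eq_self v hk]
  | succ k ih =>
    have h0 : F.depth v ≠ 0 := by omega
    rw [← F.root_parent v h0]
    exact ih _ (by have := F.depth_parent v h0; omega)

lemma root_eq_of_mem_edges {u v : V} (h : s(u, v) ∈ F.edges) : F.root u = F.root v := by
  obtain ⟨x, hx, he⟩ := h
  rcases Sym2.eq_iff.1 he with ⟨rfl, rfl⟩ | ⟨rfl, rfl⟩
  · exact (F.root_parent _ hx).symm
  · exact F.root_parent _ hx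

/-- A short forest walk joins any two vertices of the same tree. -/
lemma exists_walk_of_root_eq {u v : V} (h : F.root u = F.root v) :
    ∃ w : H.Walk u v, w.length ≤ 4 * r ∧ ∀ e ∈ w.edges, e ∈ F.edges := by
  obtain ⟨p, hp, hpe, -⟩ := F.exists_walk_root u
  obtain ⟨q, hq, hqe, -⟩ := F.exists_walk_root v
  have h1 := F.depth_le u
  have h2 := F.depth_le v
  refine ⟨(p.copy rfl h).append q.reverse, ?_, ?_⟩
  · simp; omega
  · intro e he
    simp only [Walk.edges_append, Walk.edges_copy, Walk.edges_reverse, List.mem_append,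
      List.mem_reverse] at he
    exact he.elim (hpe e) (hqe e)

/-- The graph obtained by contracting every tree of the forest to its root. -/
def quotient : SimpleGraph V where
  Adj a b := a ≠ b ∧ ∃ u v, F.root u = a ∧ F.root v = b ∧ H.Adj u v
  symm := ⟨fun _ _ ⟨hne, u, v, hu, hv, huv⟩ => ⟨hne.symm, v, u, hv, hu, huv.symm⟩⟩
  loopless := ⟨fun _ h => h.1 rfl⟩

/-- Each quotient edge lifts to an edge of `H` between two trees, and every vertex reaches its root
inside its tree. Only roots are allowed in `B`, since other vertices have empty preimage. -/
lemma connected_preimage {B : Set V} (hB : (F.quotient.induce B).Connected)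
    (hB0 : ∀ a ∈ B, F.depth a = 0) : (H.induce (F.root ⁻¹' B)).Connected := by
  have hroot : ∀ a ∈ B, F.root a ∈ B := fun a ha => by rwa [F.root_eq_self a (hB0 a ha)]
  have hlift : ∀ x (hx : F.root x ∈ B),
      (H.induce (F.root ⁻¹' B)).Reachable ⟨x, hx⟩
        ⟨F.root x, by rw [Set.mem_preimage, F.root_eq_self _ (F.depth_root x)]; exact hx⟩ := by
    intro x hx
    obtain ⟨w, -, -, hs⟩ := F.exists_walk_root x
    exact ⟨w.induce _ fun y hy => by rw [Set.mem_preimage, hs y hy]; exact hx⟩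
  obtain ⟨⟨a₀, ha₀⟩⟩ := hB.nonempty
  have key : ∀ (a b : B), (F.quotient.induce B).Walk a b →
      (H.induce (F.root ⁻¹' B)).Reachable ⟨a, hroot a a.2⟩ ⟨b, hroot b b.2⟩ := by
    intro a b w
    induction w with
    | nil => exact Reachable.refl _
    | @cons a b c hab _ ih =>
      refine Reachable.trans ?_ ih
      obtain ⟨-, u, v, hu, hv, huv⟩ := hab
      have hu' : F.root u = (a : V) := hu
      have hv' : F.root v = (b : V) := hv
      have h1 := hlift u (by rw [hu']; exact a.2)
      have h2 := hlift v (by rw [hv']; exact b.2)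
      simp only [hu'] at h1
      simp only [hv'] at h2
      refine h1.symm.trans (Reachable.trans (Adj.reachable ?_) h2)
      exact huv
  rw [connected_iff_exists_forall_reachable]
  refine ⟨⟨a₀, hroot a₀ ha₀⟩, ?_⟩
  rintro ⟨x, hx⟩
  obtain ⟨w⟩ := hB.preconnected ⟨a₀, ha₀⟩ ⟨F.root x, hx⟩
  exact (key _ _ w).trans (hlift x hx).symm

lemma isMinor_of_hasModelIn {h : ℕ} {W : Set V} (hW : ∀ a ∈ W, F.depth a = 0)
    (hmod : F.quotient.HasModelIn h W) : (completeGraph (Fin h)).IsMinor H := by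
  obtain ⟨B, hBW, hc, hd, ha⟩ := hmod
  refine ⟨fun i => F.root ⁻¹' (B i), ?_, ?_, ?_⟩
  · exact fun i => F.connected_preimage (hc i) fun a h => hW a (hBW i h)
  · exact fun i j hij => (hd i j hij).preimage _
  · intro i j hij
    obtain ⟨x, hx, y, hy, -, u, v, rfl, rfl, huv⟩ := ha i j hij.ne
    exact ⟨u, hx, v, hy, huv⟩

/-- The tree of a root that is not isolated in the quotient has more than `r` vertices. -/
lemma lt_card_fiber [Fintype V] [DecidableEq V] {a b : V} (hab : F.quotient.Adj a b) :
    r + 1 ≤ (Finset.univ.filter fun x => F.root x = a).card := by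
  obtain ⟨hne, u, v, hu, hv, huv⟩ := hab
  have ha : F.depth a = 0 := hu ▸ F.depth_root u
  have hb : F.depth b = 0 := hv ▸ F.depth_root v
  obtain ⟨p, -⟩ := F.exists_walk_root u
  obtain ⟨q, -⟩ := F.exists_walk_root v
  let w : H.Walk a b := ((p.copy rfl hu).reverse.append (.cons huv (q.copy rfl hv))).bypass
  have hw : w.IsPath := Walk.bypass_isPath _
  have hlen : 2 * r < w.length := by
    by_contra hle
    exact hne (F.separated a b ha hb w (by omega))
  -- The first `r + 1` vertices of the path belong to the tree of `a`: the `i`-th one is within `i ≤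
  -- r` of its own root, so that root is within `2 * r` of `a` and equals it.
  rw [← Finset.card_range (r + 1)]
  refine Finset.card_le_card_of_injOn w.getVert ?_ ?_
  · intro i hi
    have hi' : i ≤ r := by simpa [Nat.lt_succ_iff] using hi
    have hx : F.depth (w.getVert i) ≤ i := by
      refine (F.depth_le_length _ a ha (w.take i).reverse).trans ?_
      simp
    obtain ⟨s, hs, -⟩ := F.exists_walk_root (w.getVert i)
    have := F.separated a _ ha (F.depth_root (w.getVert i)) ((w.take i).append s) (by
      rw [Walk.length_append]
      have : (w.take i).length ≤ i := by simp
      omega)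
    simp [← this]
  · intro i hi j hj hij
    have hi' : i ≤ r := by simpa [Nat.lt_succ_iff] using hi
    have hj' : j ≤ r := by simpa [Nat.lt_succ_iff] using hj
    exact hw.getVert_injOn (by simp only [Set.mem_ofPred_eq]; omega)
      (by simp only [Set.mem_ofPred_eq]; omega) hij

section Girth

variable (hg : ∀ (a : V) (c : H.Walk a a), c.IsCycle → 8 * r + 2 < c.length)
include hg

lemma root_ne_of_notMem_edges {u v : V} (huv : H.Adj u v) (he : s(u, v) ∉ F.edges) :
    F.root u ≠ F.root v := by
  intro h
  obtain ⟨w, hw, hwe⟩ := F.exists_walk_of_root_eq h.symm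
  obtain ⟨c, hc, hlen⟩ := exists_isCycle_of_walk huv w fun h' => he (hwe _ h')
  have := hg _ c hc
  omega

/-- At most one edge joins two given trees. -/
lemma eq_of_root_eq {u v u' v' : V} (huv : H.Adj u v) (huv' : H.Adj u' v')
    (hne : F.root u ≠ F.root v) (hu : F.root u = F.root u') (hv : F.root v = F.root v') :
    s(u, v) = s(u', v') := by
  by_contra hs
  obtain ⟨p, hp, hpe⟩ := F.exists_walk_of_root_eq hv
  obtain ⟨q, hq, hqe⟩ := F.exists_walk_of_root_eq hu.symm
  -- Two crossing edges and two tree walks of length at most `4 * r` give the threshold `8 * r + 2`.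
  obtain ⟨c, hc, hlen⟩ := exists_isCycle_of_walk huv (p.append (.cons huv'.symm q)) (by
    simp only [Walk.edges_append, Walk.edges_cons, List.mem_append, List.mem_cons, not_or]
    refine ⟨fun h => hne (F.root_eq_of_mem_edges (hpe _ h)), ?_,
      fun h => hne (F.root_eq_of_mem_edges (hqe _ h))⟩
    rwa [Sym2.eq_swap (a := v')])
  have := hg _ c hc
  rw [Walk.length_append, Walk.length_cons] at hlen
  omega

lemma card_edgeFinset_le [Fintype V] [DecidableEq V] [DecidableRel H.Adj]
    [DecidableRel F.quotient.Adj] :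
    H.edgeFinset.card ≤ Fintype.card V + F.quotient.edgeFinset.card := by
  classical
  have h1 : (H.edgeFinset.filter (· ∈ F.edges)).card ≤ Fintype.card V := by
    rw [← Finset.card_univ]
    refine le_trans (Finset.card_le_card ?_)
      (Finset.card_image_le (f := fun x => s(x, F.parent x)) (s := Finset.univ))
    intro e he
    obtain ⟨x, -, rfl⟩ := (Finset.mem_filter.1 he).2
    exact Finset.mem_image_of_mem _ (Finset.mem_univ x)
  have h2 : (H.edgeFinset.filter (· ∉ F.edges)).card ≤ F.quotient.edgeFinset.card := by
    refine Finset.card_le_card_of_injOn (Sym2.map F.root) ?_ ?_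
    · intro e he
      induction e with | _ u v
      obtain ⟨huv, he⟩ := Finset.mem_filter.1 he
      rw [mem_edgeFinset, mem_edgeSet] at huv
      simp only [Sym2.map_mk, Finset.mem_coe, mem_edgeFinset, mem_edgeSet]
      exact ⟨F.root_ne_of_notMem_edges hg huv he, u, v, rfl, rfl, huv⟩
    · intro e he e' he' hee
      induction e with | _ u v
      induction e' with | _ u' v'
      obtain ⟨huv, he⟩ := Finset.mem_filter.1 he
      obtain ⟨huv', he'⟩ := Finset.mem_filter.1 he'
      rw [mem_edgeFinset, mem_edgeSet] at huv huv'
      have hne := F.root_ne_of_notMem_edges hg huv he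
      simp only [Sym2.map_mk] at hee
      rcases Sym2.eq_iff.1 hee with ⟨h1, h2⟩ | ⟨h1, h2⟩
      · exact F.eq_of_root_eq hg huv huv' hne h1 h2
      · rw [F.eq_of_root_eq hg huv huv'.symm hne h1 h2, Sym2.eq_swap]
  rw [← Finset.card_filter_add_card_filter_not (s := H.edgeFinset) (· ∈ F.edges)]
  exact Nat.add_le_add h1 h2

end Girth

end BFSForest

/-- A graph of girth larger than `8 * r + 2` without a complete minor on `h` vertices has few more
edges than vertices. -/
theorem card_edgeFinset_le_of_completeMinorFree {V : Type*} [Fintype V] [DecidableEq V]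
    (H : SimpleGraph V) [DecidableRel H.Adj] (h r : ℕ)
    (hg : ∀ (a : V) (c : H.Walk a a), c.IsCycle → 8 * r + 2 < c.length)
    (hH : H.CompleteMinorFree h) :
    (r + 1) * (2 * H.edgeFinset.card) ≤
      (r + 1) * (2 * Fintype.card V) + minorDegree h * Fintype.card V := by
  classical
  obtain ⟨F⟩ := exists_bfsForest H r
  let W : Finset V := Finset.univ.filter fun a => ∃ b, F.quotient.Adj a b
  -- The trees are disjoint, and those of vertices in `W` have at least `r + 1` vertices each.
  have hW : (r + 1) * W.card ≤ Fintype.card V := by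
    rw [← Finset.card_univ, Finset.card_eq_sum_card_fiberwise (s := Finset.univ) (f := F.root)
      (t := Finset.univ) (fun _ _ => Finset.mem_coe.2 (Finset.mem_univ _)), mul_comm,
      ← smul_eq_mul]
    refine (Finset.card_nsmul_le_sum W
      (fun a => (Finset.univ.filter fun x => F.root x = a).card) _ fun a ha => ?_).trans
      (Finset.sum_le_sum_of_subset (Finset.subset_univ W))
    obtain ⟨b, hb⟩ := (Finset.mem_filter.1 ha).2
    exact F.lt_card_fiber hb
  have hQ := two_mul_card_edgeFinset_le F.quotient h W
    (fun x y hxy => Finset.mem_filter.2 ⟨Finset.mem_univ _, y, hxy⟩) (fun hmod => by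
      refine hH (F.isMinor_of_hasModelIn (fun a ha => ?_) hmod)
      obtain ⟨b, -, u, v, rfl, -⟩ := (Finset.mem_filter.1 (Finset.mem_coe.1 ha)).2
      exact F.depth_root u)
  have hE := F.card_edgeFinset_le hg
  calc (r + 1) * (2 * H.edgeFinset.card)
      ≤ (r + 1) * (2 * (Fintype.card V + F.quotient.edgeFinset.card)) := by gcongr
    _ = (r + 1) * (2 * Fintype.card V) + (r + 1) * (2 * F.quotient.edgeFinset.card) := by ring
    _ ≤ (r + 1) * (2 * Fintype.card V) + (r + 1) * (minorDegree h * W.card) := by gcongr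
    _ = (r + 1) * (2 * Fintype.card V) + minorDegree h * ((r + 1) * W.card) := by ring
    _ ≤ _ := by gcongr

end SimpleGraph

/-! ### Cayley graphs of involutions -/

namespace SimpleGraph

section Cayley

variable {Γ ι : Type*} [Group Γ] {s : ι → Γ}

lemma mulCayley_range_adj (hs : ∀ i, s i * s i = 1) (h1 : ∀ i, s i ≠ 1) {u v : Γ} :
    (mulCayley (Set.range s)).Adj u v ↔ ∃ i, v = u * s i := by
  rw [mulCayley_adj']
  constructor
  · rintro ⟨-, _, ⟨i, rfl⟩, rfl | rfl⟩
    · exact ⟨i, rfl⟩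
    · exact ⟨i, by rw [mul_assoc, hs, mul_one]⟩
  · rintro ⟨i, rfl⟩
    exact ⟨fun h => h1 i (by simpa using h), s i, ⟨i, rfl⟩, Or.inl rfl⟩

/-- The labels along a trail of a Cayley graph of involutions form a reduced word. -/
lemma exists_reduced_word_of_isTrail (hs : ∀ i, s i * s i = 1) (h1 : ∀ i, s i ≠ 1) {u v : Γ}
    (w : (mulCayley (Set.range s)).Walk u v) (hw : w.IsTrail) :
    ∃ l : List ι, l.length = w.length ∧ v = u * (l.map s).prod ∧ l.IsChain (· ≠ ·) ∧
      ∀ i ∈ l.head?, s(u, u * s i) ∈ w.edges := by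
  induction w with
  | nil => exact ⟨[], by simp⟩
  | @cons u u' v huv w ih =>
    rw [Walk.isTrail_cons] at hw
    obtain ⟨l, hl, hv, hc, hh⟩ := ih hw.1
    obtain ⟨i, rfl⟩ := (mulCayley_range_adj hs h1).1 huv
    refine ⟨i :: l, by simp [hl], by simp [hv, mul_assoc], ?_, by simp⟩
    rw [List.isChain_cons]
    -- Equal consecutive labels would make the walk return along the edge just used.
    refine ⟨fun j hj hij => hw.2 ?_, hc⟩
    subst hij
    have := hh _ hj
    rwa [mul_assoc, hs, mul_one, Sym2.eq_swap] at this

variable {L : ℕ} (hs : ∀ i, s i * s i = 1)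
  (hfree : ∀ l : List ι, l ≠ [] → l.IsChain (· ≠ ·) → l.length ≤ L → (l.map s).prod ≠ 1)
include hs hfree

lemma lt_length_of_isCycle_mulCayley (hL : 1 ≤ L) {u : Γ}
    (w : (mulCayley (Set.range s)).Walk u u) (hw : w.IsCycle) : L < w.length := by
  have h1 : ∀ i, s i ≠ 1 := fun i => by simpa using hfree [i] (by simp) (by simp) (by simpa)
  obtain ⟨l, hl, hv, hc, -⟩ := exists_reduced_word_of_isTrail hs h1 w hw.isTrail
  by_contra hlt
  refine hfree l ?_ hc (by omega) (by simpa using hv)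
  rintro rfl
  have := hw.three_le_length
  simp at hl
  omega

/-- Nontrivial reduced words of length two make the generators distinct, hence `2 ≤ L`. -/
lemma ncard_neighborSet_mulCayley (hL : 2 ≤ L) (u : Γ) :
    ((mulCayley (Set.range s)).neighborSet u).ncard = Nat.card ι := by
  have h1 : ∀ i, s i ≠ 1 := fun i => by
    simpa using hfree [i] (by simp) (by simp) (by simp; omega)
  have hinj : Function.Injective s := by
    intro i j hij
    by_contra hne
    exact hfree [i, j] (by simp) (by simp [hne]) (by simpa using hL) (by simp [hij, hs])
  have : (mulCayley (Set.range s)).neighborSet u = Set.range fun i => u * s i := by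
    ext v
    rw [mem_neighborSet, mulCayley_range_adj hs h1]
    simp [eq_comm]
  have hinj' : Function.Injective fun i => u * s i := (mul_right_injective u).comp hinj
  rw [this, ← Set.image_univ, Set.ncard_image_of_injective _ hinj', Set.ncard_univ]

end Cayley

/-! ### Reflections of the universal Coxeter group of rank three -/

section Reflections

/-- The reflection of the universal Coxeter group of rank three in its `i`-th simple root. -/
def coxeterStep (i : Fin 3) (v : Fin 3 → ℤ) : Fin 3 → ℤ :=
  Function.update v i (2 * (v 0 + v 1 + v 2) - 3 * v i)

/-- The image of `(1, 1, 1)` under a word in the simple reflections. -/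
def coxeterOrbit (l : List (Fin 3)) : Fin 3 → ℤ := l.foldr coxeterStep 1

/-- With `j` the third index, the new entry is `2 * v k + 2 * v j - v i`. It exceeds `v k` because
`v i < v k` and `v j` is positive, and it is below `4 * v k` because `v j < v k`. -/
lemma coxeterStep_dominant {i k : Fin 3} (hik : i ≠ k) {v : Fin 3 → ℤ}
    (hv : ∀ j, 1 ≤ v j ∧ (j ≠ k → v j < v k)) :
    (∀ j, 1 ≤ coxeterStep i v j ∧ (j ≠ i → coxeterStep i v j < coxeterStep i v i)) ∧
      coxeterStep i v i ≤ 4 * v k := by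
  have h0 := hv 0
  have h1 := hv 1
  have h2 := hv 2
  rw [Fin.forall_fin_succ, Fin.forall_fin_two]
  fin_cases i <;> fin_cases k <;>
    simp [coxeterStep, Function.update] at hik h0 h1 h2 ⊢ <;> omega

lemma coxeterOrbit_dominant (l : List (Fin 3)) (i : Fin 3) (hl : (i :: l).IsChain (· ≠ ·)) :
    (∀ j, 1 ≤ coxeterOrbit (i :: l) j ∧
      (j ≠ i → coxeterOrbit (i :: l) j < coxeterOrbit (i :: l) i)) ∧
      coxeterOrbit (i :: l) i ≤ 4 ^ (l.length + 1) := by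
  induction l generalizing i with
  | nil =>
    rw [Fin.forall_fin_succ, Fin.forall_fin_two]
    fin_cases i <;> simp [coxeterOrbit, coxeterStep, Function.update]
  | cons k l ih =>
    rw [List.isChain_cons_cons] at hl
    obtain ⟨h1, h2⟩ := ih k hl.2
    obtain ⟨h3, h4⟩ := coxeterStep_dominant hl.1 h1
    refine ⟨h3, h4.trans ?_⟩
    rw [List.length_cons, pow_succ _ (l.length + 1)]
    omega

open Matrix

variable (R : Type*) [CommRing R]

/-- The matrix of `coxeterStep i`. -/
def coxeterMatrix (i : Fin 3) : Matrix (Fin 3) (Fin 3) R :=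
  Matrix.of fun a b => if a = i then (if b = i then -1 else 2) else if a = b then 1 else 0

lemma coxeterMatrix_mul_self (i : Fin 3) : coxeterMatrix R i * coxeterMatrix R i = 1 := by
  ext a b
  rw [Matrix.mul_apply, Fin.sum_univ_three]
  fin_cases i <;> fin_cases a <;> fin_cases b <;> simp [coxeterMatrix]

lemma coxeterMatrix_mulVec (i : Fin 3) (v : Fin 3 → ℤ) :
    coxeterMatrix R i *ᵥ (fun j => (v j : R)) = fun j => ((coxeterStep i v j : ℤ) : R) := by
  ext a
  rw [Matrix.mulVec, dotProduct, Fin.sum_univ_three]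
  fin_cases i <;> fin_cases a <;>
    simp [coxeterMatrix, coxeterStep, Function.update] <;> ring

/-- The simple reflections as invertible matrices. -/
def coxeterUnit (i : Fin 3) : (Matrix (Fin 3) (Fin 3) R)ˣ where
  val := coxeterMatrix R i
  inv := coxeterMatrix R i
  val_inv := coxeterMatrix_mul_self R i
  inv_val := coxeterMatrix_mul_self R i

lemma coxeterUnit_prod_mulVec (l : List (Fin 3)) :
    ((l.map (coxeterUnit R)).prod : Matrix (Fin 3) (Fin 3) R) *ᵥ 1
      = fun j => ((coxeterOrbit l j : ℤ) : R) := by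
  induction l with
  | nil => ext j; simp [coxeterOrbit]
  | cons i l ih =>
    rw [List.map_cons, List.prod_cons, Units.val_mul, ← Matrix.mulVec_mulVec, ih]
    exact coxeterMatrix_mulVec R i _

/-- The image of `(1, 1, 1)` has an entry greater than 1 and at most `4 ^ L ≤ q`, which cannot be
congruent to 1 modulo `q`. -/
lemma coxeterUnit_prod_ne_one {q L : ℕ} (hq : 4 ^ L ≤ q) (l : List (Fin 3)) (hl : l ≠ [])
    (hc : l.IsChain (· ≠ ·)) (hL : l.length ≤ L) : (l.map (coxeterUnit (ZMod q))).prod ≠ 1 := by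
  intro h
  have hv := coxeterUnit_prod_mulVec (ZMod q) l
  rw [h, Units.val_one, Matrix.one_mulVec] at hv
  cases l with
  | nil => exact hl rfl
  | cons i l =>
    obtain ⟨h1, h2⟩ := coxeterOrbit_dominant l i hc
    set x := coxeterOrbit (i :: l) i with hx
    have hgt : 1 < x := by
      obtain ⟨j, hj⟩ := exists_ne i
      have := h1 j
      have := this.2 hj
      omega
    have hdvd : (q : ℤ) ∣ x - 1 := by
      rw [← ZMod.intCast_zmod_eq_zero_iff_dvd, Int.cast_sub, Int.cast_one, ← congrFun hv i]
      simp
    have hle := Int.le_of_dvd (by omega) hdvd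
    have hpow : (4 : ℤ) ^ (l.length + 1) ≤ q := by
      refine le_trans (pow_le_pow_right₀ (by norm_num) (by simpa using hL)) ?_
      exact_mod_cast hq
    omega

end Reflections

/-! ### Cubic graphs of logarithmic girth -/

/-- A finite graph all of whose vertices have degree three contains a cycle. -/
lemma not_isAcyclic_of_cubic {V : Type*} [Fintype V] [Nonempty V] (G : SimpleGraph V)
    [DecidableRel G.Adj] (hG : G.IsRegularOfDegree 3) : ¬ G.IsAcyclic := by
  classical
  intro hac
  -- An acyclic graph extends to a spanning tree, so it has fewer edges than vertices, whereas a
  -- cubic graph has 3/2 as many.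
  obtain ⟨T, hGT, -, hT⟩ :=
    (connected_top (V := V)).exists_isTree_le_of_le_of_isAcyclic le_top hac
  have h1 := hT.card_edgeFinset
  have h2 := Finset.card_le_card (edgeFinset_mono hGT)
  have h3 := G.sum_degrees_eq_twice_card_edges
  simp only [hG.degree_eq, Finset.sum_const, Finset.card_univ, smul_eq_mul] at h3
  omega

/-- Through `ncard`, regularity needs no decidability instance, so the family can be a plain set of
graphs. -/
lemma isRegularOfDegree_iff_ncard {V : Type*} [Fintype V] (G : SimpleGraph V)
    [DecidableRel G.Adj] {d : ℕ} :
    G.IsRegularOfDegree d ↔ ∀ v, (G.neighborSet v).ncard = d := by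
  refine forall_congr' fun v => ?_
  rw [← card_neighborFinset_eq_degree, neighborFinset, Set.ncard_eq_toFinset_card']

/-- There are cubic graphs with arbitrarily many vertices whose girth is logarithmic in the number
of vertices. -/
theorem exists_cubic_graph_girth (N : ℕ) :
    ∃ n, N ≤ n ∧ ∃ G : SimpleGraph (Fin n), (∀ v, (G.neighborSet v).ncard = 3) ∧
      1 / (9 * Real.log 4) * Real.log n ≤ G.girth := by
  classical
  set L := N + 2 with hL
  set q := 4 ^ L with hq
  have : NeZero q := ⟨by positivity⟩
  let Γ := (Matrix (Fin 3) (Fin 3) (ZMod q))ˣ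
  let C : SimpleGraph Γ := mulCayley (Set.range (coxeterUnit (ZMod q)))
  have hs : ∀ i, coxeterUnit (ZMod q) i * coxeterUnit (ZMod q) i = 1 := fun i =>
    Units.ext (coxeterMatrix_mul_self _ i)
  have hfree := fun l h1 h2 h3 => coxeterUnit_prod_ne_one (q := q) (L := L) le_rfl l h1 h2 h3
  let n := Fintype.card Γ
  let e : Fin n ≃ Γ := (Fintype.equivFin Γ).symm
  let φ : C.comap e ≃g C := Iso.comap e C
  -- Nine matrix entries; hence the 9 in the girth constant.
  have hcard : n ≤ q ^ 9 := by
    refine (Fintype.card_le_of_injective (fun x : Γ => (x : Matrix (Fin 3) (Fin 3) (ZMod q)))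
      Units.val_injective).trans ?_
    rw [Fintype.card_eq_nat_card, Matrix, Nat.card_fun, Nat.card_fun, ← pow_mul]
    simp
  have hreg : ∀ v, ((C.comap e).neighborSet v).ncard = 3 := by
    intro v
    have h1 : (C.comap e).neighborSet v = e ⁻¹' C.neighborSet (e v) := rfl
    rw [h1, Set.ncard_preimage_of_injective_subset_range e.injective (by simp [e.surjective.range_eq]),
      ncard_neighborSet_mulCayley hs hfree (by omega), Nat.card_eq_fintype_card, Fintype.card_fin]
  have hpos : 0 < n := Fintype.card_pos
  have : Nonempty (Fin n) := ⟨⟨0, hpos⟩⟩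
  have hac : ¬ (C.comap e).IsAcyclic :=
    not_isAcyclic_of_cubic _ ((isRegularOfDegree_iff_ncard _).2 hreg)
  have hgirth : L < (C.comap e).girth := by
    rw [φ.girth_eq]
    rw [φ.isAcyclic_iff] at hac
    obtain ⟨a, w, hw, hlen⟩ := exists_girth_eq_length.2 hac
    rw [hlen]
    exact lt_length_of_isCycle_mulCayley hs hfree (by omega) w hw
  refine ⟨n, ?_, C.comap e, hreg, ?_⟩
  -- A shortest cycle has more than `L` vertices, so `n` is at least `N`.
  · obtain ⟨a, w, hw, hlen⟩ := exists_girth_eq_length.2 hac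
    have h1 := hw.isPath_tail.length_lt
    rw [Fintype.card_fin, Walk.length_tail] at h1
    omega
  · have h4 : 0 < Real.log 4 := Real.log_pos (by norm_num)
    have h1 : Real.log n ≤ 9 * Real.log 4 * L := by
      calc Real.log n ≤ Real.log ((q : ℝ) ^ 9) :=
            Real.log_le_log (by exact_mod_cast hpos) (by exact_mod_cast hcard)
        _ = 9 * Real.log 4 * L := by
            rw [hq]; push_cast; rw [Real.log_pow, Real.log_pow]; push_cast; ring
    rw [one_div, inv_mul_le_iff₀ (by positivity)]
    refine h1.trans ?_
    gcongr
end SimpleGraph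

/-! ### Counting edges and the final estimate -/

namespace SimpleGraph

/-- Deleting the vertices outside `S` destroys at most `d` edges for each of them. -/
lemma card_edgeFinset_le_induce_add {V : Type*} [Fintype V] [DecidableEq V] (G : SimpleGraph V)
    [DecidableRel G.Adj] {d : ℕ} (hG : G.IsRegularOfDegree d) (S : Finset V)
    [DecidableRel (G.induce (S : Set V)).Adj] :
    G.edgeFinset.card ≤ (G.induce (S : Set V)).edgeFinset.card + Sᶜ.card * d := by
  have hsub : G.edgeFinset ⊆
      (G.induce (S : Set V)).edgeFinset.image (Sym2.map Subtype.val) ∪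
        Sᶜ.biUnion fun v => G.incidenceFinset v := by
    intro e he
    induction e with | _ u v
    rw [mem_edgeFinset, mem_edgeSet] at he
    rw [Finset.mem_union, Finset.mem_image, Finset.mem_biUnion]
    by_cases hu : u ∈ S
    · by_cases hv : v ∈ S
      · refine Or.inl ⟨s(⟨u, hu⟩, ⟨v, hv⟩), ?_, rfl⟩
        rw [mem_edgeFinset, mem_edgeSet]
        exact he
      · exact Or.inr ⟨v, Finset.mem_compl.2 hv, by simp [incidenceSet, he]⟩
    · exact Or.inr ⟨u, Finset.mem_compl.2 hu, by simp [incidenceSet, he]⟩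
  refine (Finset.card_le_card hsub).trans ((Finset.card_union_le _ _).trans ?_)
  refine Nat.add_le_add Finset.card_image_le (Finset.card_biUnion_le_card_mul _ _ _ fun v _ => ?_)
  rw [card_incidenceFinset_eq_degree, hG.degree_eq]

/-- A set inducing a graph without a complete minor on `h` vertices in a cubic graph of girth `g`
misses almost a quarter of the vertices. -/
lemma card_le_of_completeMinorFree_of_cubic {n : ℕ} (G : SimpleGraph (Fin n)) [DecidableRel G.Adj]
    (hG : G.IsRegularOfDegree 3) (h : ℕ) (hg : 3 ≤ G.girth) (S : Finset (Fin n))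
    (hS : (G.induce (S : Set (Fin n))).CompleteMinorFree h) :
    G.girth * (4 * S.card) ≤ G.girth * (3 * n) + 24 * minorDegree h * n := by
  classical
  set g := G.girth with hgdef
  -- The largest `r` with `8 * r + 2 < g`.
  set r := (g - 3) / 8 with hr
  have hmain := card_edgeFinset_le_of_completeMinorFree (G.induce (S : Set (Fin n))) h r
    (fun a c hc => by
      have h1 : G.egirth ≤ c.length :=
        (IsContained.egirth_le ⟨(Embedding.induce (S : Set (Fin n))).toCopy⟩).trans
          (egirth_le_length hc)
      have h2 : g ≤ c.length := ENat.toNat_le_of_le_natCast h1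
      omega) hS
  have hcard : Fintype.card (S : Set (Fin n)) = S.card := by simp
  rw [hcard] at hmain
  have hE := G.card_edgeFinset_le_induce_add hG S
  have hm := G.sum_degrees_eq_twice_card_edges
  simp only [hG.degree_eq, Finset.sum_const, Finset.card_univ, smul_eq_mul, Fintype.card_fin] at hm
  have hSn : S.card ≤ n := by simpa using Finset.card_le_univ S
  rw [Finset.card_compl, Fintype.card_fin] at hE
  have h6 : 6 * S.card ≤ 3 * n + 2 * (G.induce (S : Set (Fin n))).edgeFinset.card := by omega
  have h4 : (r + 1) * (4 * S.card) ≤ (r + 1) * (3 * n) + minorDegree h * S.card := by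
    have := Nat.mul_le_mul_left (r + 1) h6
    nlinarith
  by_contra hlt
  push Not at hlt
  have hlt' : 3 * n < 4 * S.card := by
    by_contra hle
    have := Nat.mul_le_mul_left g (not_lt.1 hle)
    omega
  obtain ⟨k, hk⟩ := Nat.exists_eq_add_of_lt hlt'
  rw [hk] at hlt h4
  have hgr : g ≤ 24 * (r + 1) := by omega
  have e1 : g * (k + 1) ≤ 24 * (r + 1) * (k + 1) := Nat.mul_le_mul_right _ hgr
  have e2 : minorDegree h * S.card ≤ minorDegree h * n := Nat.mul_le_mul_left _ hSn
  nlinarith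

end SimpleGraph

open SimpleGraph in
theorem theorem4 (h : ℕ) :
    ∃ (F : (n : ℕ) → Set (SimpleGraph (Fin n))) (c C : ℝ), 0 < c ∧
      (∀ N : ℕ, ∃ n : ℕ, N ≤ n ∧ (F n).Nonempty) ∧
      ∀ (n : ℕ) (G : SimpleGraph (Fin n)) [DecidableRel G.Adj], G ∈ F n →
        G.IsRegularOfDegree 3 ∧
        c * Real.log (n : ℝ) ≤ (G.girth : ℝ) ∧
        ∀ S : Finset (Fin n), (G.induce (S : Set (Fin n))).CompleteMinorFree h →
          (S.card : ℝ) ≤ (n : ℝ) - (G.edgeFinset.card : ℝ) / 6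
            + C * ((G.edgeFinset.card : ℝ) / Real.log (G.edgeFinset.card : ℝ)) := by
  have h4 : 0 < Real.log 4 := Real.log_pos (by norm_num)
  set c : ℝ := 1 / (9 * Real.log 4) with hc
  have hc0 : 0 < c := by positivity
  refine ⟨fun n => {G | (∀ v, (G.neighborSet v).ncard = 3) ∧ c * Real.log n ≤ G.girth}, c,
    -- The error is `6 * D * (n / g)` with `D = minorDegree h`; then `n ≤ m`, `g ≥ c * log n` and
    -- `log m ≤ 2 * log n` contribute the factor `2 / c`.
    12 * minorDegree h / c, hc0, ?_, ?_⟩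
  · intro N
    obtain ⟨n, hn, G, hG⟩ := exists_cubic_graph_girth N
    exact ⟨n, hn, G, hG⟩
  · rintro n G _ ⟨hreg, hgirth⟩
    rw [← isRegularOfDegree_iff_ncard] at hreg
    refine ⟨hreg, hgirth, fun S hS => ?_⟩
    have hm := G.sum_degrees_eq_twice_card_edges
    simp only [hreg.degree_eq, Finset.sum_const, Finset.card_univ, smul_eq_mul,
      Fintype.card_fin] at hm
    have hSn : S.card ≤ n := by simpa using Finset.card_le_univ S
    rcases Nat.eq_zero_or_pos n with hn0 | hn0
    -- For `n = 0` the error term is `0 / log 0`, which is 0 by convention.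
    · have h1 : G.edgeFinset.card = 0 := by omega
      have h2 : S.card = 0 := by omega
      rw [h1, h2, hn0]
      simp
    · have : Nonempty (Fin n) := ⟨⟨0, hn0⟩⟩
      have hg3 := three_le_girth (not_isAcyclic_of_cubic G hreg)
      have hn4 : 3 < n := by
        have := G.degree_lt_card_verts ⟨0, hn0⟩
        rwa [hreg.degree_eq, Fintype.card_fin] at this
      have key := card_le_of_completeMinorFree_of_cubic G hreg h hg3 S hS
      set m := G.edgeFinset.card
      set g := G.girth
      set D := minorDegree h
      have hm' : (m : ℝ) = 3 / 2 * n := by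
        have : ((n * 3 : ℕ) : ℝ) = ((2 * m : ℕ) : ℝ) := by rw [hm]
        push_cast at this
        linarith
      have hnR : (3 : ℝ) < n := by exact_mod_cast hn4
      have hlogn : 0 < Real.log n := Real.log_pos (by linarith)
      have hlogm : 0 < Real.log m := Real.log_pos (by rw [hm']; linarith)
      have hlog : Real.log m ≤ 2 * Real.log n := by
        have : Real.log ((n : ℝ) ^ 2) = 2 * Real.log n := by rw [Real.log_pow]; norm_num
        rw [← this]
        exact Real.log_le_log (by rw [hm']; linarith) (by rw [hm']; nlinarith)
      have hgpos : (0 : ℝ) < g := by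
        have : 0 < g := by omega
        exact_mod_cast this
      have keyR : (g : ℝ) * (4 * S.card) ≤ g * (3 * n) + 24 * D * n := by exact_mod_cast key
      have h1 : (S.card : ℝ) ≤ 3 / 4 * n + 6 * D * (n / g) := by
        rw [← mul_le_mul_iff_right₀ hgpos]
        have : (g : ℝ) * (3 / 4 * n + 6 * D * (n / g)) = g * (3 / 4 * n) + 6 * D * n := by
          field_simp
        rw [this]
        linarith
      have h2 : (n : ℝ) / g ≤ 2 / c * (m / Real.log m) := by
        calc (n : ℝ) / g ≤ m / (c * Real.log n) := by
              gcongr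
              omega
          _ ≤ m / (c * (Real.log m / 2)) := by
              gcongr
              linarith
          _ = 2 / c * (m / Real.log m) := by field_simp
      calc (S.card : ℝ) ≤ 3 / 4 * n + 6 * D * (n / g) := h1
        _ ≤ 3 / 4 * n + 6 * D * (2 / c * (m / Real.log m)) := by gcongr
        _ = (n : ℝ) - m / 6 + 12 * D / c * (m / Real.log m) := by rw [hm']; ring
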